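/- Let $\alpha>0$ be real and let $N$ be an integer with $10\le N<10+4\alpha$. Then the equation $$\Delta u+|x|^\alpha e^u=0\quad\text{in }\mathbb R^N$$ has no weak solution that is stable at infinity. Here a weak solution is a real-valued function $u\in L^1_{loc}(\mathbb R^N)$ with weak gradient $\nabla u\in L^2_{loc}(\mathbb R^N)$ and $|x|^\alpha e^u\in L^1_{loc}(\mathbb R^N)$ such that $$\int_{\mathbb R^N}\big(\nabla u\cdot\nabla\psi-|x|^\alpha e^u\psi\big)\,dx=0\qquad\text{for all }\psi\in C^1_c(\mathbb R^N),$$ and $u$ is stable at infinity if there is a compact set $K\subset\mathbb R^N$ such that $$\int_{\mathbb R^N\setminus K}\big(|\nabla\varphi|^2-|x|^\alpha e^u\varphi^2\big)\,dx\ge 0\qquad\text{for all }\varphi\in C^1_c(\mathbb R^N\setminus K).$$ -/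

import Mathlib

open MeasureTheory

open scoped ContDiff

/-- `g` is the weak (distributional) gradient on `ℝ^N` of the locally integrable function `u`:
`∫ u ∂ᵢφ = - ∫ gᵢ φ` for all `φ ∈ C_c^∞(ℝ^N)` and all `i`. -/
def IsWeakGradient {N : ℕ} (u : EuclideanSpace ℝ (Fin N) → ℝ)
    (g : EuclideanSpace ℝ (Fin N) → EuclideanSpace ℝ (Fin N)) : Prop :=
  LocallyIntegrable u ∧ LocallyIntegrable g ∧
    ∀ φ : EuclideanSpace ℝ (Fin N) → ℝ, ContDiff ℝ ∞ φ → HasCompactSupport φ →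
      ∀ i : Fin N,
        ∫ x, u x * fderiv ℝ φ x (EuclideanSpace.single i 1) = - ∫ x, g x i * φ x

/-- Weak solutions of `Δu + |x|^α e^u = 0` in `ℝ^N`: `u` is locally integrable with
`∇u ∈ L²_loc(ℝ^N)`, `|x|^α e^u ∈ L¹_loc(ℝ^N)`, and
`∫ (∇u · ∇ψ - |x|^α e^u ψ) dx = 0` for all `ψ ∈ C_c^1(ℝ^N)`. -/
def IsWeakSolution {N : ℕ} (α : ℝ) (u : EuclideanSpace ℝ (Fin N) → ℝ) : Prop :=
  LocallyIntegrable (fun x => ‖x‖ ^ α * Real.exp (u x)) ∧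
    ∃ g : EuclideanSpace ℝ (Fin N) → EuclideanSpace ℝ (Fin N),
      IsWeakGradient u g ∧
      LocallyIntegrable (fun x => ‖g x‖ ^ 2) ∧
      ∀ ψ : EuclideanSpace ℝ (Fin N) → ℝ, ContDiff ℝ 1 ψ → HasCompactSupport ψ →
        ∫ x, (inner ℝ (g x) (gradient ψ x) - ‖x‖ ^ α * Real.exp (u x) * ψ x) = 0

/-- `u` is stable on the open set `Ω`:
`∫_Ω (|∇φ|² - |x|^α e^u φ²) dx ≥ 0` for all `φ ∈ C_c^1(Ω)`. -/
def IsStableOn {N : ℕ} (α : ℝ) (u : EuclideanSpace ℝ (Fin N) → ℝ)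
    (Ω : Set (EuclideanSpace ℝ (Fin N))) : Prop :=
  ∀ φ : EuclideanSpace ℝ (Fin N) → ℝ, ContDiff ℝ 1 φ → HasCompactSupport φ → tsupport φ ⊆ Ω →
    0 ≤ ∫ x in Ω, (‖gradient φ x‖ ^ 2 - ‖x‖ ^ α * Real.exp (u x) * φ x ^ 2)

/-- `u` is stable at infinity: it is stable on the complement of some compact set. -/
def IsStableAtInfinity {N : ℕ} (α : ℝ) (u : EuclideanSpace ℝ (Fin N) → ℝ) : Prop :=
  ∃ K : Set (EuclideanSpace ℝ (Fin N)), IsCompact K ∧ IsStableOn α u Kᶜ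

/-!
Write `V = |x|^α e^u`, `n = N`, and use the variable `s = ‖x‖ ^ 2` for radial functions. The
contradiction comes from testing the equation and the stability inequality with radial functions
only, so no regularity of `u` is needed; it works for every `N ≥ 3` with `N < 10 + 4 α`.

*Upper bound for the mass.* Stability outside a compact set, tested with the extremal profile
`‖x‖ ^ (-(n - 2) / 2)` of Hardy's inequality cut off to `A ≲ ‖x‖ ^ 2 ≲ B`, bounds
`∫ V ‖x‖ ^ (2 - n)` over that region by `κ (n - 2)² / 4 * log B + O(1)`, where `κ` is half the
area of the unit sphere (`IsStableAtInfinity.exists_hardy_mass_le`).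

*Slow decay of the averages.* Let `c(B)` be the average of `u` over the shell
`B < ‖x‖ ^ 2 < 2 B` with the weight `shellWeight N B`. The equation tested against
`shellPotential N A B`, the radial potential of the difference of two such weights, reads
`2 (n - 2) κ (c(A) - c(B)) = ∫ V * potential`
(`IsWeakSolution.integral_mul_shellPotential`). The potential is at most `‖x‖ ^ (2 - n)`, so the
mass bound yields `c(B) ≥ -(n - 2) / 8 * log B - O(1)`.

*Contradiction.* Jensen's inequality (`shell_average_lower_bound`) bounds the weighted integral of
`V` over the shell below by a constant times `B ^ (α / 2) e ^ c(B)`, while the mass bound gives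
`O(log B / B)` for it (`integral_mul_shellWeight_le`). Hence
`B ^ (α / 2 + 1 - (n - 2) / 8) = O(log B)` as `B → ∞`. The exponent is positive exactly when
`n < 10 + 4 α`.
-/

/-! ### Smooth cutoffs -/

/-- A smooth probability density on `ℝ`, positive exactly on `(1, 2)`. -/
noncomputable def unitDensity : ℝ → ℝ :=
  (⟨1 / 4, 1 / 2, by norm_num, by norm_num⟩ : ContDiffBump (3 / 2 : ℝ)).normed volume

lemma unitDensity_nonneg (t : ℝ) : 0 ≤ unitDensity t := ContDiffBump.nonneg_normed _ _

lemma contDiff_unitDensity : ContDiff ℝ ∞ unitDensity := ContDiffBump.contDiff_normed _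

lemma support_unitDensity : Function.support unitDensity = Set.Ioo 1 2 := by
  rw [unitDensity, ContDiffBump.support_normed_eq, Real.ball_eq_Ioo]
  norm_num

lemma unitDensity_eq_zero {t : ℝ} (h : t ≤ 1 ∨ 2 ≤ t) : unitDensity t = 0 := by
  by_contra h0
  have : t ∈ Function.support unitDensity := h0
  rw [support_unitDensity] at this
  rcases h with h | h
  · exact absurd this.1 (not_lt.2 h)
  · exact absurd this.2 (not_lt.2 h)

lemma exists_mul_unitDensity_le : ∃ D : ℝ, 0 < D ∧ ∀ t, unitDensity t ≤ D ∧ t * unitDensity t ≤ D := by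
  obtain ⟨C, hC⟩ := contDiff_unitDensity.continuous.bounded_above_of_compact_support
    (ContDiffBump.hasCompactSupport_normed _)
  refine ⟨2 * |C| + 1, by positivity, fun t => ?_⟩
  have h1 : unitDensity t ≤ |C| := (le_abs_self _).trans ((hC t).trans (le_abs_self C))
  have h0 := unitDensity_nonneg t
  refine ⟨by linarith [abs_nonneg C], ?_⟩
  rcases le_or_gt 2 t with h | h
  · rw [unitDensity_eq_zero (Or.inr h)]; simp; positivity
  · nlinarith

/-- The probability density `unitDensity` rescaled to the interval `(c, 2c)`. -/
noncomputable def rampDensity (c s : ℝ) : ℝ := unitDensity (s / c) / c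

/-- The primitive of `rampDensity c`: a smooth monotone function equal to `0` on `(-∞, c]` and to
`1` on `[2c, ∞)`. -/
noncomputable def ramp (c s : ℝ) : ℝ := ∫ t in (0 : ℝ)..s / c, unitDensity t

lemma hasDerivAt_ramp (c s : ℝ) : HasDerivAt (ramp c) (rampDensity c s) s := by
  have h1 : HasDerivAt (fun y => ∫ t in (0 : ℝ)..y, unitDensity t) (unitDensity (s / c)) (s / c) :=
    intervalIntegral.integral_hasDerivAt_right
      (contDiff_unitDensity.continuous.intervalIntegrable _ _)
      (contDiff_unitDensity.continuous.stronglyMeasurableAtFilter _ _)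
      contDiff_unitDensity.continuous.continuousAt
  have h2 : HasDerivAt (fun y : ℝ => y / c) (1 / c) s := (hasDerivAt_id s).div_const c
  have := h1.comp s h2
  rwa [mul_one_div] at this

lemma contDiff_rampDensity (c : ℝ) : ContDiff ℝ ∞ (rampDensity c) :=
  (contDiff_unitDensity.comp (contDiff_id.div_const c)).div_const c

lemma contDiff_ramp (c : ℝ) : ContDiff ℝ ∞ (ramp c) := by
  have h : deriv (ramp c) = rampDensity c := funext fun s => (hasDerivAt_ramp c s).deriv
  rw [contDiff_infty_iff_deriv, h]
  exact ⟨fun s => (hasDerivAt_ramp c s).differentiableAt, contDiff_rampDensity c⟩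

section Ramp

variable {c s : ℝ}

lemma rampDensity_nonneg (hc : 0 < c) : 0 ≤ rampDensity c s :=
  div_nonneg (unitDensity_nonneg _) hc.le

lemma rampDensity_eq_zero (hc : 0 < c) (h : s ≤ c ∨ 2 * c ≤ s) : rampDensity c s = 0 := by
  rw [rampDensity, unitDensity_eq_zero, zero_div]
  rwa [div_le_one hc, le_div_iff₀ hc]

lemma ramp_eq_zero (hc : 0 < c) (h : s ≤ c) : ramp c s = 0 := by
  rw [ramp, intervalIntegral.integral_congr (g := fun _ => 0), intervalIntegral.integral_zero]
  intro t ht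
  refine unitDensity_eq_zero (Or.inl (ht.2.trans ?_))
  exact max_le zero_le_one ((div_le_one hc).2 h)

lemma ramp_eq_one (hc : 0 < c) (h : 2 * c ≤ s) : ramp c s = 1 := by
  rw [ramp, intervalIntegral.integral_eq_integral_of_support_subset]
  · exact ContDiffBump.integral_normed _
  · rw [support_unitDensity]
    intro t ht
    exact ⟨by linarith [ht.1], ht.2.le.trans ((le_div_iff₀ hc).2 h)⟩

lemma monotone_ramp (hc : 0 < c) : Monotone (ramp c) :=
  monotone_of_deriv_nonneg (fun s => (hasDerivAt_ramp c s).differentiableAt) fun s => by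
    rw [(hasDerivAt_ramp c s).deriv]; exact rampDensity_nonneg hc

lemma ramp_nonneg (hc : 0 < c) : 0 ≤ ramp c s := by
  rw [← ramp_eq_zero hc (min_le_right s c)]
  exact monotone_ramp hc (min_le_left s c)

lemma ramp_le_one (hc : 0 < c) : ramp c s ≤ 1 := by
  rw [← ramp_eq_one hc (le_max_right s (2 * c))]
  exact monotone_ramp hc (le_max_left s _)

/-- The ramp at scale `c'` starts later than the ramp at scale `c ≤ c'`, hence lies below it. -/
lemma ramp_le_ramp {c' : ℝ} (hc : 0 < c) (h : c ≤ c') : ramp c' s ≤ ramp c s := by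
  rcases le_or_gt s 0 with hs | hs
  · rw [ramp_eq_zero (hc.trans_le h) (hs.trans (hc.trans_le h).le), ramp_eq_zero hc (hs.trans hc.le)]
  · have h1 : ∀ d : ℝ, ramp d s = ramp 1 (s / d) := fun d => by simp [ramp]
    rw [h1 c', h1 c]
    exact monotone_ramp one_pos (div_le_div_of_nonneg_left hs.le hc h)

end Ramp

/-- A smooth function of `s`, equal to `0` outside `(a, 2b)` and to `1` on `[2a, b]`. -/
noncomputable def plateau (a b s : ℝ) : ℝ := ramp a s - ramp b s

section Plateau

variable {a b s : ℝ}

lemma hasDerivAt_plateau (a b s : ℝ) :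
    HasDerivAt (plateau a b) (rampDensity a s - rampDensity b s) s :=
  (hasDerivAt_ramp a s).sub (hasDerivAt_ramp b s)

lemma contDiff_plateau (a b : ℝ) : ContDiff ℝ ∞ (plateau a b) :=
  (contDiff_ramp a).sub (contDiff_ramp b)

lemma plateau_nonneg (ha : 0 < a) (hab : a ≤ b) : 0 ≤ plateau a b s :=
  sub_nonneg.2 (ramp_le_ramp ha hab)

lemma plateau_le_one (ha : 0 < a) (hb : 0 < b) : plateau a b s ≤ 1 := by
  have := ramp_le_one (s := s) ha
  have := ramp_nonneg (s := s) hb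
  unfold plateau; linarith

lemma plateau_eq_zero_of_le (ha : 0 < a) (hab : a ≤ b) (h : s ≤ a) : plateau a b s = 0 := by
  rw [plateau, ramp_eq_zero ha h, ramp_eq_zero (ha.trans_le hab) (h.trans hab), sub_zero]

lemma plateau_eq_zero_of_ge (ha : 0 < a) (hab : a ≤ b) (h : 2 * b ≤ s) : plateau a b s = 0 := by
  rw [plateau, ramp_eq_one ha (by linarith), ramp_eq_one (ha.trans_le hab) h, sub_self]

lemma plateau_eq_one (ha : 0 < a) (hb : 0 < b) (h1 : 2 * a ≤ s) (h2 : s ≤ b) :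
    plateau a b s = 1 := by
  rw [plateau, ramp_eq_one ha h1, ramp_eq_zero hb h2, sub_zero]

/-- The product is smooth also at `s = 0`, where `s ^ p` may be singular, because the plateau
vanishes for `s ≤ a`. -/
lemma contDiff_rpow_mul_plateau (ha : 0 < a) (hab : a ≤ b) (p : ℝ) :
    ContDiff ℝ ∞ fun s => s ^ p * plateau a b s := by
  rw [contDiff_iff_contDiffAt]
  intro s
  rcases lt_or_ge s a with hs | hs
  · refine (contDiffAt_const (c := (0 : ℝ))).congr_of_eventuallyEq ?_
    filter_upwards [Iio_mem_nhds hs] with t ht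
    rw [plateau_eq_zero_of_le ha hab (le_of_lt ht), mul_zero]
  · exact (Real.contDiffAt_rpow_const_of_ne (ha.trans_le hs).ne').mul
      (contDiff_plateau a b).contDiffAt

lemma hasDerivAt_rpow_mul_plateau (p : ℝ) (hs : 0 < s) :
    HasDerivAt (fun s => s ^ p * plateau a b s)
      (p * s ^ (p - 1) * plateau a b s + s ^ p * (rampDensity a s - rampDensity b s)) s :=
  (Real.hasDerivAt_rpow_const (Or.inl hs.ne')).mul (hasDerivAt_plateau a b s)

end Plateau

/-! ### Radial functions -/

section Radial

variable {E : Type*} [NormedAddCommGroup E] [InnerProductSpace ℝ E]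

lemma hasGradientAt_comp_norm_sq [CompleteSpace E] {q : ℝ → ℝ} {q' : ℝ} {x : E}
    (h : HasDerivAt q q' (‖x‖ ^ 2)) :
    HasGradientAt (fun x : E => q (‖x‖ ^ 2)) ((2 * q') • x) x := by
  rw [hasGradientAt_iff_hasFDerivAt]
  have h2 := h.comp_hasFDerivAt x (hasStrictFDerivAt_norm_sq x).hasFDerivAt
  refine h2.congr_fderiv ?_
  ext y
  simp [InnerProductSpace.toDual_apply_apply]
  ring

lemma hasCompactSupport_comp_norm_sq [FiniteDimensional ℝ E] {F : Type*} [Zero F] {f : E → F}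
    {R : ℝ} (h : ∀ x, R ≤ ‖x‖ ^ 2 → f x = 0) : HasCompactSupport f := by
  have : ProperSpace E := FiniteDimensional.proper ℝ E
  refine HasCompactSupport.intro (isCompact_closedBall (0 : E) (Real.sqrt R)) fun x hx => h x ?_
  rw [mem_closedBall_zero_iff, not_le] at hx
  exact (Real.sqrt_le_left (norm_nonneg x)).1 hx.le

open Module Set in
/-- Integration in the variable `s = ‖x‖ ^ 2`. -/
lemma integral_comp_norm_sq [FiniteDimensional ℝ E] [Nontrivial E] [MeasurableSpace E]
    [BorelSpace E] (μ : Measure E) [μ.IsAddHaarMeasure] (f : ℝ → ℝ) :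
    ∫ x, f (‖x‖ ^ 2) ∂μ = finrank ℝ E * μ.real (Metric.ball 0 1) / 2 *
      ∫ s in Ioi (0 : ℝ), s ^ ((finrank ℝ E : ℝ) / 2 - 1) * f s := by
  rw [integral_fun_norm_addHaar μ fun r => f (r ^ 2), nsmul_eq_mul, smul_eq_mul,
    ← integral_comp_rpow_Ioi_of_pos (g := fun s => s ^ ((finrank ℝ E : ℝ) / 2 - 1) * f s) two_pos,
    ← mul_assoc, div_mul_eq_mul_div, mul_div_assoc, ← integral_div]
  congr 1
  refine setIntegral_congr_fun measurableSet_Ioi fun r hr => ?_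
  have hr : 0 < r := hr
  have hd : 1 ≤ finrank ℝ E := finrank_pos
  have h : r ^ (finrank ℝ E - 1) = r * (r ^ (2 : ℝ)) ^ ((finrank ℝ E : ℝ) / 2 - 1) := by
    rw [← Real.rpow_mul hr.le, ← Real.rpow_natCast, Nat.cast_sub hd]
    nth_rw 2 [← Real.rpow_one r]
    rw [← Real.rpow_add hr]
    congr 1
    push_cast; ring
  simp only [smul_eq_mul, h, Real.rpow_two]
  rw [show (2 : ℝ) - 1 = 1 by norm_num, Real.rpow_one]
  ring

end Radial

/-! ### Shell weights and the energy of the Hardy profile -/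

section Energy

variable {N : ℕ}

/-- Half the area of the unit sphere of `ℝ^N`: the constant in
`∫ f (‖x‖ ^ 2) dx = halfSphereArea N * ∫ s in Ioi 0, s ^ (N / 2 - 1) * f s`. -/
noncomputable def halfSphereArea (N : ℕ) : ℝ :=
  N * (volume : Measure (EuclideanSpace ℝ (Fin N))).real (Metric.ball 0 1) / 2

lemma halfSphereArea_pos (hN : 3 ≤ N) : 0 < halfSphereArea N := by
  have h : 0 < (volume : Measure (EuclideanSpace ℝ (Fin N))).real (Metric.ball 0 1) :=
    ENNReal.toReal_pos (Metric.measure_ball_pos _ _ one_pos).ne' measure_ball_lt_top.ne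
  have : (0 : ℝ) < N := by exact_mod_cast (by omega : 0 < N)
  unfold halfSphereArea; positivity

lemma integral_euclidean_comp_norm_sq (hN : 3 ≤ N) (f : ℝ → ℝ) :
    ∫ x : EuclideanSpace ℝ (Fin N), f (‖x‖ ^ 2) =
      halfSphereArea N * ∫ s in Set.Ioi (0 : ℝ), s ^ ((N : ℝ) / 2 - 1) * f s := by
  have : Nonempty (Fin N) := ⟨⟨0, by omega⟩⟩
  simpa [halfSphereArea] using
    integral_comp_norm_sq (volume : Measure (EuclideanSpace ℝ (Fin N))) f

/-- The weight `‖x‖ ^ (2 - N) * rampDensity B (‖x‖ ^ 2)`, written in `s = ‖x‖ ^ 2`; a constant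
multiple of it is the charge density whose Newtonian potential is `‖x‖ ^ (2 - N)` for
`‖x‖ ^ 2 ≥ 2 * B`. -/
noncomputable def shellWeight (N : ℕ) (B s : ℝ) : ℝ := s ^ (1 - (N : ℝ) / 2) * rampDensity B s

lemma shellWeight_nonneg {B s : ℝ} (hB : 0 < B) (hs : 0 ≤ s) : 0 ≤ shellWeight N B s :=
  mul_nonneg (Real.rpow_nonneg hs _) (rampDensity_nonneg hB)

lemma shellWeight_eq_zero {B s : ℝ} (hB : 0 < B) (h : s ≤ B ∨ 2 * B ≤ s) :
    shellWeight N B s = 0 := by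
  rw [shellWeight, rampDensity_eq_zero hB h, mul_zero]

lemma continuous_shellWeight {B : ℝ} (hB : 0 < B) : Continuous (shellWeight N B) := by
  rw [continuous_iff_continuousAt]
  intro s
  rcases lt_or_ge s B with hs | hs
  · refine (continuousAt_const (y := (0 : ℝ))).congr ?_
    filter_upwards [Iio_mem_nhds hs] with t ht
    rw [shellWeight_eq_zero hB (Or.inl (le_of_lt ht))]
  · exact (Real.continuousAt_rpow_const _ _ (Or.inl (hB.trans_le hs).ne')).mul
      (contDiff_rampDensity B).continuous.continuousAt

lemma integral_shellWeight (hN : 3 ≤ N) {B : ℝ} (hB : 0 < B) :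
    ∫ x : EuclideanSpace ℝ (Fin N), shellWeight N B (‖x‖ ^ 2) = halfSphereArea N := by
  have h : ∫ s in Set.Ioi (0 : ℝ), s ^ ((N : ℝ) / 2 - 1) * shellWeight N B s =
      ∫ s in Set.Ioi (0 : ℝ), rampDensity B s := by
    refine setIntegral_congr_fun measurableSet_Ioi fun s hs => ?_
    have hs : 0 < s := hs
    simp only [shellWeight]
    rw [← mul_assoc, ← Real.rpow_add hs]
    simp
  rw [integral_euclidean_comp_norm_sq hN, h,
    integral_Ioi_of_hasDerivAt_of_nonneg (g := ramp B) (l := 1)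
      (contDiff_ramp B).continuous.continuousWithinAt (fun s _ => hasDerivAt_ramp B s)
      (fun s _ => rampDensity_nonneg hB), ramp_eq_zero hB hB.le, sub_zero, mul_one]
  refine tendsto_const_nhds.congr' ?_
  filter_upwards [Filter.eventually_ge_atTop (2 * B)] with s hs
  rw [ramp_eq_one hB hs]

lemma integral_rampDensity_le {c a b : ℝ} (hc : 0 < c) :
    ∫ s in a..b, rampDensity c s ≤ 1 := by
  rw [intervalIntegral.integral_eq_sub_of_hasDerivAt (fun s _ => hasDerivAt_ramp c s)
    ((contDiff_rampDensity c).continuous.intervalIntegrable _ _)]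
  linarith [ramp_le_one (s := b) hc, ramp_nonneg (s := a) hc]

/-- The extremal profile `‖x‖ ^ (-(N - 2) / 2)` of Hardy's inequality, written in `s = ‖x‖ ^ 2`
and cut off outside `(a, 2b)`. -/
noncomputable def hardyProfile (N : ℕ) (a b s : ℝ) : ℝ :=
  s ^ (-((N : ℝ) - 2) / 4) * plateau a b s

lemma hardyProfile_sq {a b s : ℝ} (hs : 0 < s) :
    hardyProfile N a b s ^ 2 = s ^ (1 - (N : ℝ) / 2) * plateau a b s ^ 2 := by
  rw [hardyProfile, mul_pow, ← Real.rpow_mul_natCast hs.le]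
  congr 2
  push_cast; ring

/-- The truncated Hardy profile has Dirichlet energy `(N - 2)² / 4 * log (2b / a) + O(1)`, up to the
factor `halfSphereArea N`. -/
lemma exists_energy_hardyProfile_le (hN : 3 ≤ N) : ∃ C : ℝ, 0 < C ∧ ∀ a b : ℝ, 0 < a → a ≤ b →
    ∫ x : EuclideanSpace ℝ (Fin N), ‖gradient (fun x => hardyProfile N a b (‖x‖ ^ 2)) x‖ ^ 2 ≤
      halfSphereArea N * (((N : ℝ) - 2) ^ 2 / 4 * Real.log (2 * b / a) + C) := by
  obtain ⟨D, hD, hDt⟩ := exists_mul_unitDensity_le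
  have hn : (3 : ℝ) ≤ N := by exact_mod_cast hN
  refine ⟨2 * (2 * ((N : ℝ) - 2) + 8 * D), by nlinarith, fun a b ha hab => ?_⟩
  have hb : 0 < b := ha.trans_le hab
  have hsmooth : ContDiff ℝ ∞ (hardyProfile N a b) := contDiff_rpow_mul_plateau ha hab _
  have hgrad : ∀ x : EuclideanSpace ℝ (Fin N),
      ‖gradient (fun x => hardyProfile N a b (‖x‖ ^ 2)) x‖ ^ 2 =
        (fun s => 4 * s * deriv (hardyProfile N a b) s ^ 2) (‖x‖ ^ 2) := by
    intro x
    rw [(hasGradientAt_comp_norm_sq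
      ((hsmooth.differentiable (by simp)) (‖x‖ ^ 2)).hasDerivAt).gradient, norm_smul, mul_pow,
      Real.norm_eq_abs, sq_abs]
    ring
  have hzero : ∀ s, s < a ∨ 2 * b < s → deriv (hardyProfile N a b) s = 0 := by
    intro s hs
    have : hardyProfile N a b =ᶠ[nhds s] fun _ => 0 := by
      rcases hs with hs | hs
      · filter_upwards [Iio_mem_nhds hs] with t ht
        rw [hardyProfile, plateau_eq_zero_of_le ha hab (le_of_lt ht), mul_zero]
      · filter_upwards [Ioi_mem_nhds hs] with t ht
        rw [hardyProfile, plateau_eq_zero_of_ge ha hab (le_of_lt ht), mul_zero]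
    rw [this.deriv_eq, deriv_const]
  have hcontR : ∀ c, Continuous (rampDensity c) := fun c => (contDiff_rampDensity c).continuous
  have hint : ∀ s, s ∈ Set.uIcc a (2 * b) → 0 < s := fun s hs => by
    rw [Set.uIcc_of_le (by linarith)] at hs; exact ha.trans_le hs.1
  have hinv : IntervalIntegrable (fun s : ℝ => s⁻¹) volume a (2 * b) :=
    intervalIntegral.intervalIntegrable_inv (fun s hs => (hint s hs).ne') continuousOn_id
  have hramps : IntervalIntegrable (fun s => rampDensity a s + rampDensity b s) volume a (2 * b) :=
    ((hcontR a).add (hcontR b)).intervalIntegrable _ _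
  rw [integral_congr_ae (ae_of_all _ hgrad),
    integral_euclidean_comp_norm_sq hN fun s => 4 * s * deriv (hardyProfile N a b) s ^ 2]
  refine mul_le_mul_of_nonneg_left ?_ (halfSphereArea_pos hN).le
  have hsub : ∫ s in Set.Ioi (0 : ℝ),
        s ^ ((N : ℝ) / 2 - 1) * (4 * s * deriv (hardyProfile N a b) s ^ 2) =
      ∫ s in a..2 * b,
        s ^ ((N : ℝ) / 2 - 1) * (4 * s * deriv (hardyProfile N a b) s ^ 2) := by
    rw [intervalIntegral.integral_of_le (by linarith), ← integral_Icc_eq_integral_Ioc]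
    refine setIntegral_eq_of_subset_of_forall_sdiff_eq_zero measurableSet_Ioi
      (fun s hs => ha.trans_le hs.1) fun s hs => ?_
    have : s < a ∨ 2 * b < s := by
      by_contra! h; exact hs.2 ⟨h.1, h.2⟩
    rw [hzero s this]; ring
  rw [hsub]
  calc ∫ s in a..2 * b, s ^ ((N : ℝ) / 2 - 1) * (4 * s * deriv (hardyProfile N a b) s ^ 2)
      ≤ ∫ s in a..2 * b, (((N : ℝ) - 2) ^ 2 / 4 * s⁻¹ +
          (2 * ((N : ℝ) - 2) + 8 * D) * (rampDensity a s + rampDensity b s)) := by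
        refine intervalIntegral.integral_mono_on (by linarith) ?_ ?_ fun s hs => ?_
        · refine ContinuousOn.intervalIntegrable fun s hs => ?_
          refine ContinuousAt.continuousWithinAt ?_
          have := (hsmooth.continuous_deriv (by simp)).continuousAt (x := s)
          exact (Real.continuousAt_rpow_const _ _ (Or.inl (hint s hs).ne')).mul
            ((continuousAt_const.mul continuousAt_id).mul (this.pow 2))
        · exact (hinv.const_mul _).add (hramps.const_mul _)
        · have hs0 : 0 < s := ha.trans_le hs.1
          set p : ℝ := -((N : ℝ) - 2) / 4 with hp
          set z := plateau a b s
          set δ := rampDensity a s - rampDensity b s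
          have hd : deriv (hardyProfile N a b) s = s ^ p * (p * z * s⁻¹ + δ) := by
            rw [show deriv (hardyProfile N a b) s = _ from
              (hasDerivAt_rpow_mul_plateau p hs0).deriv, Real.rpow_sub_one hs0.ne']
            field_simp
            rfl
          have hpow : s ^ ((N : ℝ) / 2 - 1) * (s ^ p) ^ 2 = 1 := by
            rw [← Real.rpow_mul_natCast hs0.le, ← Real.rpow_add hs0, hp]
            convert Real.rpow_zero s using 2
            push_cast; ring
          have heq : s ^ ((N : ℝ) / 2 - 1) * (4 * s * deriv (hardyProfile N a b) s ^ 2) =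
              4 * p ^ 2 * z ^ 2 * s⁻¹ + 8 * p * z * δ + 4 * (s * δ ^ 2) := by
            rw [hd]
            calc _ = (s ^ ((N : ℝ) / 2 - 1) * (s ^ p) ^ 2) * (4 * s * (p * z * s⁻¹ + δ) ^ 2) := by
                  ring
              _ = _ := by rw [hpow]; field_simp; ring
          have hz0 : 0 ≤ z := plateau_nonneg ha hab
          have hz1 : z ≤ 1 := plateau_le_one ha hb
          have hra := rampDensity_nonneg (s := s) ha
          have hrb := rampDensity_nonneg (s := s) hb
          have hle : ∀ c, 0 < c → s * rampDensity c s ≤ D := fun c hc => by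
            rw [rampDensity, mul_div_assoc', mul_comm, mul_div_assoc, mul_comm]
            exact (hDt _).2
          have h1 : 4 * p ^ 2 * z ^ 2 * s⁻¹ ≤ ((N : ℝ) - 2) ^ 2 / 4 * s⁻¹ := by
            refine mul_le_mul_of_nonneg_right ?_ (inv_nonneg.2 hs0.le)
            have : z ^ 2 ≤ 1 := pow_le_one₀ hz0 hz1
            have h4 : 4 * p ^ 2 = ((N : ℝ) - 2) ^ 2 / 4 := by rw [hp]; ring
            rw [h4]
            exact mul_le_of_le_one_right (by positivity) this
          have h2 : 8 * p * z * δ ≤ 2 * ((N : ℝ) - 2) * (rampDensity a s + rampDensity b s) := by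
            have : -(z * δ) ≤ rampDensity a s + rampDensity b s := by
              have : -δ ≤ rampDensity a s + rampDensity b s := by simp only [δ]; linarith
              nlinarith
            have h8 : 8 * p * z * δ = 2 * ((N : ℝ) - 2) * (-(z * δ)) := by rw [hp]; ring
            rw [h8]
            exact mul_le_mul_of_nonneg_left this (by linarith)
          have h3 : 4 * (s * δ ^ 2) ≤ 8 * D * (rampDensity a s + rampDensity b s) := by
            have ha' := mul_le_mul_of_nonneg_right (hle a ha) hra
            have hb' := mul_le_mul_of_nonneg_right (hle b hb) hrb
            have : δ ^ 2 ≤ 2 * (rampDensity a s ^ 2 + rampDensity b s ^ 2) := by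
              simp only [δ]; nlinarith [sq_nonneg (rampDensity a s + rampDensity b s)]
            nlinarith [mul_le_mul_of_nonneg_left this hs0.le]
          rw [heq]
          linarith
    _ ≤ _ := by
        rw [intervalIntegral.integral_add (hinv.const_mul _) (hramps.const_mul _),
          intervalIntegral.integral_const_mul, intervalIntegral.integral_const_mul,
          integral_inv (fun h => (hint 0 h).ne' rfl),
          intervalIntegral.integral_add ((hcontR a).intervalIntegrable _ _)
            ((hcontR b).intervalIntegrable _ _)]
        have h1 := integral_rampDensity_le (a := a) (b := 2 * b) ha
        have h2 := integral_rampDensity_le (a := a) (b := 2 * b) hb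
        nlinarith

end Energy

/-! ### The potential of two shells -/

section Potential

/-- The radial potential of the charge `shellWeight N A - shellWeight N B`, in `s = ‖x‖ ^ 2` and
normalized to agree with `‖x‖ ^ (2 - N)` up to a constant where `2 * A ≤ ‖x‖ ^ 2 ≤ B`. The total
charge is zero, so the potential vanishes for `‖x‖ ^ 2 ≥ 2 * B`. -/
noncomputable def shellPotential (N : ℕ) (A B s : ℝ) : ℝ :=
  ∫ t in s..2 * B, ((N : ℝ) - 2) / 2 * (t ^ (-(N : ℝ) / 2) * plateau A B t)

variable {N : ℕ} {A B s : ℝ}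

lemma continuous_shellPotential_integrand (hA : 0 < A) (hAB : A ≤ B) :
    Continuous fun t : ℝ => ((N : ℝ) - 2) / 2 * (t ^ (-(N : ℝ) / 2) * plateau A B t) :=
  continuous_const.mul (contDiff_rpow_mul_plateau hA hAB _).continuous

lemma hasDerivAt_shellPotential (hA : 0 < A) (hAB : A ≤ B) (s : ℝ) :
    HasDerivAt (shellPotential N A B)
      (-(((N : ℝ) - 2) / 2 * (s ^ (-(N : ℝ) / 2) * plateau A B s))) s := by
  have h := continuous_shellPotential_integrand (N := N) hA hAB
  exact intervalIntegral.integral_hasDerivAt_left (h.intervalIntegrable _ _)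
    (h.stronglyMeasurableAtFilter _ _) h.continuousAt

lemma shellPotential_eq_zero (hA : 0 < A) (hAB : A ≤ B) (hs : 2 * B ≤ s) :
    shellPotential N A B s = 0 := by
  rw [shellPotential, intervalIntegral.integral_congr (g := fun _ => 0),
    intervalIntegral.integral_zero]
  intro t ht
  rw [Set.uIcc_of_ge hs] at ht
  simp only [plateau_eq_zero_of_ge hA hAB ht.1, mul_zero]

lemma shellPotential_le (hN : 3 ≤ N) (hA : 0 < A) (hAB : A ≤ B) (hs : 0 < s) :
    shellPotential N A B s ≤ s ^ (1 - (N : ℝ) / 2) := by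
  have hn : (3 : ℝ) ≤ N := by exact_mod_cast hN
  rcases le_or_gt (2 * B) s with h | h
  · rw [shellPotential_eq_zero hA hAB h]; positivity
  have hB : 0 < B := hA.trans_le hAB
  have h0 : (0 : ℝ) ∉ Set.uIcc s (2 * B) := by
    rw [Set.uIcc_of_le h.le]; exact fun h' => absurd h'.1 (not_le.2 hs)
  calc shellPotential N A B s
      ≤ ∫ t in s..2 * B, ((N : ℝ) - 2) / 2 * t ^ (-(N : ℝ) / 2) := by
        refine intervalIntegral.integral_mono_on h.le
          ((continuous_shellPotential_integrand hA hAB).intervalIntegrable _ _)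
          ((intervalIntegral.intervalIntegrable_rpow (Or.inr h0)).const_mul _) fun t ht => ?_
        have ht0 : 0 < t := hs.trans_le ht.1
        refine mul_le_mul_of_nonneg_left ?_ (by linarith)
        exact mul_le_of_le_one_right (Real.rpow_nonneg ht0.le _) (plateau_le_one hA hB)
    _ = s ^ (1 - (N : ℝ) / 2) - (2 * B) ^ (1 - (N : ℝ) / 2) := by
        rw [intervalIntegral.integral_const_mul, integral_rpow (Or.inr ⟨by linarith, h0⟩),
          show -(N : ℝ) / 2 + 1 = 1 - (N : ℝ) / 2 by ring]
        have : 1 - (N : ℝ) / 2 ≠ 0 := by linarith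
        rw [show ((N : ℝ) - 2) / 2 = -(1 - (N : ℝ) / 2) by ring, neg_mul, mul_div_cancel₀ _ this,
          neg_sub]
    _ ≤ _ := by linarith [Real.rpow_nonneg (by linarith : (0 : ℝ) ≤ 2 * B) (1 - (N : ℝ) / 2)]

lemma shellPotential_le_const (hN : 3 ≤ N) (hA : 0 < A) (hAB : A ≤ B) (hs : s ≤ A) :
    shellPotential N A B s ≤ A ^ (1 - (N : ℝ) / 2) := by
  have h := continuous_shellPotential_integrand (N := N) hA hAB
  rw [shellPotential, ← intervalIntegral.integral_add_adjacent_intervals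
    (h.intervalIntegrable s A) (h.intervalIntegrable A (2 * B)),
    intervalIntegral.integral_congr (a := s) (b := A) (g := fun _ => 0),
    intervalIntegral.integral_zero, zero_add]
  · exact shellPotential_le hN hA hAB hA
  · intro t ht
    rw [Set.uIcc_of_le hs] at ht
    simp only [plateau_eq_zero_of_le hA hAB ht.2, mul_zero]

end Potential

/-! ### The equation and the stability inequality on radial test functions -/

section WeakForm

variable {N : ℕ} {α : ℝ} {u : EuclideanSpace ℝ (Fin N) → ℝ}

lemma integrable_mul_of_hasCompactSupport {f h : EuclideanSpace ℝ (Fin N) → ℝ}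
    (hf : LocallyIntegrable f) (hh : Continuous h) (hc : HasCompactSupport h) :
    Integrable fun x => f x * h x :=
  hf.integrable_smul_right_of_hasCompactSupport hh hc

/-- The equation tested against the radial function `q (‖x‖ ^ 2)` with `q' = k / 2`, whose Laplacian
is `N * k s + 2 * s * k' s` at `s = ‖x‖ ^ 2`. -/
lemma IsWeakSolution.integral_mul_radial (hu : IsWeakSolution α u) {q k : ℝ → ℝ} {R : ℝ}
    (hk : ContDiff ℝ ∞ k) (hq : ∀ s, HasDerivAt q (k s / 2) s) (hkR : ∀ s, R ≤ s → k s = 0)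
    (hqR : ∀ s, R ≤ s → q s = 0) :
    ∫ x, ‖x‖ ^ α * Real.exp (u x) * q (‖x‖ ^ 2) =
      -∫ x, u x * (N * k (‖x‖ ^ 2) + 2 * ‖x‖ ^ 2 * deriv k (‖x‖ ^ 2)) := by
  obtain ⟨hV, g, ⟨hul, hgl, hug⟩, -, hw⟩ := hu
  set Φ : EuclideanSpace ℝ (Fin N) → ℝ := fun x => q (‖x‖ ^ 2) with hΦ
  let φ : Fin N → EuclideanSpace ℝ (Fin N) → ℝ := fun i x => k (‖x‖ ^ 2) * x i
  have hq1 : ContDiff ℝ 1 q := by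
    have h : deriv q = fun s => k s / 2 := funext fun s => (hq s).deriv
    rw [contDiff_one_iff_deriv, h]
    exact ⟨fun s => (hq s).differentiableAt, hk.continuous.div_const 2⟩
  have hΦ1 : ContDiff ℝ 1 Φ := hq1.comp (contDiff_norm_sq ℝ)
  have hΦc : HasCompactSupport Φ := hasCompactSupport_comp_norm_sq fun x hx => hqR _ hx
  have hgradΦ : ∀ x, gradient Φ x = k (‖x‖ ^ 2) • x := fun x => by
    rw [(hasGradientAt_comp_norm_sq (hq (‖x‖ ^ 2))).gradient, mul_div_cancel₀ _ two_ne_zero]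
  have hksm : ContDiff ℝ ∞ fun x : EuclideanSpace ℝ (Fin N) => k (‖x‖ ^ 2) :=
    hk.comp (contDiff_norm_sq ℝ)
  have hcoord : ∀ i, ContDiff ℝ ∞ fun x : EuclideanSpace ℝ (Fin N) => x i := fun i =>
    (EuclideanSpace.proj (𝕜 := ℝ) i).contDiff
  have hφs : ∀ i, ContDiff ℝ ∞ (φ i) := fun i => hksm.mul (hcoord i)
  have hφc : ∀ i, HasCompactSupport (φ i) := fun i =>
    hasCompactSupport_comp_norm_sq (R := R) fun x hx => by simp only [φ, hkR _ hx, zero_mul]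
  have hgi : ∀ i, LocallyIntegrable fun x => g x i := fun i x =>
    let ⟨U, hU, hi⟩ := hgl x
    ⟨U, hU, (EuclideanSpace.proj (𝕜 := ℝ) i : EuclideanSpace ℝ (Fin N) →L[ℝ] ℝ).integrable_comp hi⟩
  have hder : ∀ i x, fderiv ℝ (φ i) x (EuclideanSpace.single i 1) =
      k (‖x‖ ^ 2) + 2 * x i ^ 2 * deriv k (‖x‖ ^ 2) := by
    intro i x
    have h1 : HasFDerivAt (fun x : EuclideanSpace ℝ (Fin N) => k (‖x‖ ^ 2)) _ x :=
      ((hk.differentiable (by simp) (‖x‖ ^ 2)).hasDerivAt).comp_hasFDerivAt x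
        (hasStrictFDerivAt_norm_sq x).hasFDerivAt
    have h2 : HasFDerivAt (fun x : EuclideanSpace ℝ (Fin N) => x i)
        (EuclideanSpace.proj (𝕜 := ℝ) i : EuclideanSpace ℝ (Fin N) →L[ℝ] ℝ) x :=
      (EuclideanSpace.proj (𝕜 := ℝ) i : EuclideanSpace ℝ (Fin N) →L[ℝ] ℝ).hasFDerivAt
    rw [show fderiv ℝ (φ i) x = _ from (h1.mul h2).fderiv]
    simp [EuclideanSpace.inner_single_right]
    ring
  have hui : ∀ i, Integrable fun x => u x * fderiv ℝ (φ i) x (EuclideanSpace.single i 1) :=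
    fun i => by
      refine integrable_mul_of_hasCompactSupport hul ?_ ?_
      · exact ((hφs i).continuous_fderiv (by simp)).clm_apply continuous_const
      · exact (hφc i).fderiv_apply (𝕜 := ℝ) _
  have hgφ : ∀ i, Integrable fun x => g x i * φ i x := fun i =>
    integrable_mul_of_hasCompactSupport (hgi i) (hφs i).continuous (hφc i)
  have hinner : ∀ x, inner ℝ (g x) (gradient Φ x) = ∑ i, g x i * φ i x := fun x => by
    rw [hgradΦ, inner_smul_right, PiLp.inner_apply, Finset.mul_sum]
    refine Finset.sum_congr rfl fun i _ => ?_
    simp [φ]; ring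
  have hsum : ∀ x, ∑ i, u x * fderiv ℝ (φ i) x (EuclideanSpace.single i 1) =
      u x * (N * k (‖x‖ ^ 2) + 2 * ‖x‖ ^ 2 * deriv k (‖x‖ ^ 2)) := fun x => by
    have hn : ∑ i, x i ^ 2 = ‖x‖ ^ 2 := by simp [EuclideanSpace.norm_sq_eq]
    rw [← Finset.mul_sum]
    simp only [hder, Finset.sum_add_distrib, ← Finset.sum_mul, ← Finset.mul_sum, hn]
    simp
  have hVΦ := integrable_mul_of_hasCompactSupport hV hΦ1.continuous hΦc
  have hmain := hw Φ hΦ1 hΦc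
  simp only [hinner] at hmain
  rw [integral_sub (integrable_finsetSum _ fun i _ => hgφ i) hVΦ,
    integral_finsetSum _ fun i _ => hgφ i, sub_eq_zero] at hmain
  rw [← hmain, ← integral_congr_ae (ae_of_all _ hsum), integral_finsetSum _ fun i _ => hui i,
    ← Finset.sum_neg_distrib]
  exact Finset.sum_congr rfl fun i _ => by rw [hug (φ i) (hφs i) (hφc i) i, neg_neg]

/-- Testing the equation against `shellPotential N A B` compares the averages of `u` over the two
shells. -/
lemma IsWeakSolution.integral_mul_shellPotential (hu : IsWeakSolution α u) {A B : ℝ} (hA : 0 < A)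
    (hAB : A ≤ B) :
    ∫ x, ‖x‖ ^ α * Real.exp (u x) * shellPotential N A B (‖x‖ ^ 2) =
      2 * ((N : ℝ) - 2) * ((∫ x, u x * shellWeight N A (‖x‖ ^ 2)) -
        ∫ x, u x * shellWeight N B (‖x‖ ^ 2)) := by
  have hB : 0 < B := hA.trans_le hAB
  have hul := hu.2.choose_spec.1.1
  have hcs : ∀ c, 0 < c → Integrable fun x => u x * shellWeight N c (‖x‖ ^ 2) := fun c hc =>
    integrable_mul_of_hasCompactSupport hul
      ((continuous_shellWeight hc).comp (continuous_norm.pow 2))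
      (hasCompactSupport_comp_norm_sq fun x hx => shellWeight_eq_zero hc (Or.inr hx))
  let k : ℝ → ℝ := fun s => -((N : ℝ) - 2) * (s ^ (-(N : ℝ) / 2) * plateau A B s)
  have hk : ContDiff ℝ ∞ k := contDiff_const.mul (contDiff_rpow_mul_plateau hA hAB _)
  rw [hu.integral_mul_radial (R := 2 * B) hk, ← integral_sub (hcs A hA) (hcs B hB),
    ← integral_const_mul, ← integral_neg]
  · refine integral_congr_ae (ae_of_all _ fun x => ?_)
    have key : ∀ s : ℝ, 0 ≤ s → N * k s + 2 * s * deriv k s =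
        -(2 * ((N : ℝ) - 2) * (shellWeight N A s - shellWeight N B s)) := by
      intro s hs
      rcases lt_or_ge s A with h | h
      · have h0 : k =ᶠ[nhds s] fun _ => 0 := by
          filter_upwards [Iio_mem_nhds h] with t ht
          simp only [k, plateau_eq_zero_of_le hA hAB (le_of_lt ht), mul_zero]
        rw [h0.deriv_eq, h0.self_of_nhds, shellWeight_eq_zero hA (Or.inl h.le),
          shellWeight_eq_zero hB (Or.inl (h.le.trans hAB))]
        simp
      · have hs0 : 0 < s := hA.trans_le h
        have hd : deriv k s = _ := ((hasDerivAt_rpow_mul_plateau (a := A) (b := B)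
          (-(N : ℝ) / 2) hs0).const_mul (-((N : ℝ) - 2))).deriv
        have hpow : s ^ (1 - (N : ℝ) / 2) = s * s ^ (-(N : ℝ) / 2) := by
          rw [show 1 - (N : ℝ) / 2 = 1 + -(N : ℝ) / 2 by ring, Real.rpow_add hs0, Real.rpow_one]
        rw [hd, Real.rpow_sub_one hs0.ne']
        simp only [k, shellWeight, hpow]
        field_simp
        ring
    simp only [key _ (sq_nonneg ‖x‖)]
    ring
  · intro s
    convert hasDerivAt_shellPotential (N := N) hA hAB s using 1
    simp only [k]; ring
  · intro s hs
    simp only [k, plateau_eq_zero_of_ge hA hAB hs, mul_zero]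
  · exact fun s hs => shellPotential_eq_zero hA hAB hs

lemma IsStableOn.integral_mul_sq_le {K : Set (EuclideanSpace ℝ (Fin N))}
    (hV : LocallyIntegrable fun x => ‖x‖ ^ α * Real.exp (u x)) (hs : IsStableOn α u Kᶜ)
    {φ : EuclideanSpace ℝ (Fin N) → ℝ} (hφ : ContDiff ℝ 1 φ) (hc : HasCompactSupport φ)
    (hK : tsupport φ ⊆ Kᶜ) :
    ∫ x, ‖x‖ ^ α * Real.exp (u x) * φ x ^ 2 ≤ ∫ x, ‖gradient φ x‖ ^ 2 := by
  have h := hs φ hφ hc hK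
  have hgrad : ∀ x, ‖gradient φ x‖ = ‖fderiv ℝ φ x‖ := fun x => by
    rw [← toDual_gradient, LinearIsometryEquiv.norm_map]
  have hd : ∀ x, x ∉ tsupport φ → fderiv ℝ φ x = 0 := fun x hx => by
    by_contra h0
    exact hx (support_fderiv_subset ℝ h0)
  have h1 : Integrable fun x => ‖gradient φ x‖ ^ 2 := by
    simp only [hgrad]
    refine ((hφ.continuous_fderiv (by simp)).norm.pow 2).integrable_of_hasCompactSupport ?_
    exact HasCompactSupport.intro hc fun x hx => by simp [hd x hx]
  have h2 : Integrable fun x => ‖x‖ ^ α * Real.exp (u x) * φ x ^ 2 :=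
    integrable_mul_of_hasCompactSupport hV (hφ.continuous.pow 2)
      (HasCompactSupport.intro hc fun x hx => by simp [image_eq_zero_of_notMem_tsupport hx])
  rw [setIntegral_eq_integral_of_forall_compl_eq_zero, integral_sub h1 h2] at h
  · linarith
  · intro x hx
    have hx' : x ∉ tsupport φ := fun h => hx (hK h)
    rw [hgrad, hd x hx', image_eq_zero_of_notMem_tsupport hx']
    simp

end WeakForm

/-! ### Averages over shells and the mass bound -/

section Growth

variable {N : ℕ} {α : ℝ} {u : EuclideanSpace ℝ (Fin N) → ℝ}

/-- Jensen's inequality for the exponential and the shell average, in tangent-line form: if the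
average of `u` is at least `c`, then that of `e ^ u` is at least `e ^ c`. -/
lemma shell_average_lower_bound (hN : 3 ≤ N) (hα : 0 ≤ α)
    (hV : LocallyIntegrable fun x => ‖x‖ ^ α * Real.exp (u x)) (hul : LocallyIntegrable u)
    {B c : ℝ} (hB : 0 < B)
    (hc : c * halfSphereArea N ≤ ∫ x, u x * shellWeight N B (‖x‖ ^ 2)) :
    B ^ (α / 2) * Real.exp c * halfSphereArea N ≤
      ∫ x, ‖x‖ ^ α * Real.exp (u x) * shellWeight N B (‖x‖ ^ 2) := by
  have hcont : Continuous fun x : EuclideanSpace ℝ (Fin N) => shellWeight N B (‖x‖ ^ 2) :=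
    (continuous_shellWeight hB).comp (continuous_norm.pow 2)
  have hcs : HasCompactSupport fun x : EuclideanSpace ℝ (Fin N) => shellWeight N B (‖x‖ ^ 2) :=
    hasCompactSupport_comp_norm_sq fun x hx => shellWeight_eq_zero hB (Or.inr hx)
  have hW := hcont.integrable_of_hasCompactSupport (μ := volume) hcs
  have huW := integrable_mul_of_hasCompactSupport hul hcont hcs
  calc B ^ (α / 2) * Real.exp c * halfSphereArea N
      ≤ B ^ (α / 2) * Real.exp c * ((1 - c) * halfSphereArea N +
          ∫ x, u x * shellWeight N B (‖x‖ ^ 2)) :=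
        mul_le_mul_of_nonneg_left (by linarith) (by positivity)
    _ = ∫ x, B ^ (α / 2) * Real.exp c * ((1 - c) * shellWeight N B (‖x‖ ^ 2) +
          u x * shellWeight N B (‖x‖ ^ 2)) := by
        rw [integral_const_mul, integral_add (hW.const_mul _) huW, integral_const_mul,
          integral_shellWeight hN hB]
    _ ≤ _ := by
        refine integral_mono (((hW.const_mul _).add huW).const_mul _)
          (integrable_mul_of_hasCompactSupport hV hcont hcs) fun x => ?_
        have hw0 : 0 ≤ shellWeight N B (‖x‖ ^ 2) := shellWeight_nonneg hB (sq_nonneg _)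
        rcases le_or_gt (‖x‖ ^ 2) B with h | h
        · simp [shellWeight_eq_zero hB (Or.inl h)]
        have h1 : B ^ (α / 2) ≤ ‖x‖ ^ α := by
          have : ‖x‖ ^ α = (‖x‖ ^ 2) ^ (α / 2) := by
            rw [← Real.rpow_natCast_mul (norm_nonneg x)]
            congr 1
            push_cast; ring
          rw [this]
          exact Real.rpow_le_rpow hB.le h.le (by linarith)
        have h2 : Real.exp c * (1 - c + u x) ≤ Real.exp (u x) := by
          have := Real.add_one_le_exp (u x - c)
          calc Real.exp c * (1 - c + u x) ≤ Real.exp c * Real.exp (u x - c) :=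
                mul_le_mul_of_nonneg_left (by linarith) (Real.exp_pos c).le
            _ = _ := by rw [← Real.exp_add]; ring_nf
        calc B ^ (α / 2) * Real.exp c * ((1 - c) * shellWeight N B (‖x‖ ^ 2) +
              u x * shellWeight N B (‖x‖ ^ 2))
            = B ^ (α / 2) * (Real.exp c * (1 - c + u x)) * shellWeight N B (‖x‖ ^ 2) := by ring
          _ ≤ ‖x‖ ^ α * Real.exp (u x) * shellWeight N B (‖x‖ ^ 2) := by
            refine mul_le_mul_of_nonneg_right ?_ hw0
            calc _ ≤ B ^ (α / 2) * Real.exp (u x) := mul_le_mul_of_nonneg_left h2 (by positivity)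
              _ ≤ _ := mul_le_mul_of_nonneg_right h1 (Real.exp_pos _).le

lemma integrable_mul_hardyProfile_sq (hV : LocallyIntegrable fun x => ‖x‖ ^ α * Real.exp (u x))
    {a b : ℝ} (ha : 0 < a) (hab : a ≤ b) :
    Integrable fun x => ‖x‖ ^ α * Real.exp (u x) * hardyProfile N a b (‖x‖ ^ 2) ^ 2 :=
  integrable_mul_of_hasCompactSupport hV
    (((contDiff_rpow_mul_plateau ha hab _).continuous.comp (continuous_norm.pow 2)).pow 2)
    (hasCompactSupport_comp_norm_sq (R := 2 * b) fun x hx => by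
      simp [hardyProfile, plateau_eq_zero_of_ge ha hab hx])

/-- Stability outside a compact set, tested with the truncated Hardy profile: the mass
`∫ V ‖x‖ ^ (2 - N)` over `A ≤ ‖x‖ ^ 2 ≤ B` grows at most like
`halfSphereArea N * (N - 2)² / 4 * log B`. -/
lemma IsStableAtInfinity.exists_hardy_mass_le (hN : 3 ≤ N)
    (hV : LocallyIntegrable fun x => ‖x‖ ^ α * Real.exp (u x)) (hs : IsStableAtInfinity α u) :
    ∃ A C : ℝ, 0 < A ∧ ∀ t : ℝ, 0 ≤ t →
      ∫ x, ‖x‖ ^ α * Real.exp (u x) *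
        hardyProfile N (A / 2) (2 * (A * Real.exp t)) (‖x‖ ^ 2) ^ 2 ≤
      halfSphereArea N * (((N : ℝ) - 2) ^ 2 / 4 * t + C) := by
  obtain ⟨K, hK, hst⟩ := hs
  obtain ⟨r, hr⟩ := hK.isBounded.exists_norm_le
  obtain ⟨C, -, hC⟩ := exists_energy_hardyProfile_le hN
  set A : ℝ := 2 * (r ^ 2 + 1) with hA
  have hA0 : 0 < A := by positivity
  refine ⟨A, ((N : ℝ) - 2) ^ 2 / 4 * Real.log 8 + C, hA0, fun t ht => ?_⟩
  have ha : 0 < A / 2 := by positivity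
  have hexp : 1 ≤ Real.exp t := Real.one_le_exp ht
  have hab : A / 2 ≤ 2 * (A * Real.exp t) := by nlinarith
  have hsm : ContDiff ℝ ∞ (hardyProfile N (A / 2) (2 * (A * Real.exp t))) :=
    contDiff_rpow_mul_plateau ha hab _
  have hzero : ∀ x : EuclideanSpace ℝ (Fin N), ‖x‖ ^ 2 ≤ A / 2 →
      hardyProfile N (A / 2) (2 * (A * Real.exp t)) (‖x‖ ^ 2) = 0 := fun x hx => by
    rw [hardyProfile, plateau_eq_zero_of_le ha hab hx, mul_zero]
  refine (hst.integral_mul_sq_le hV ((hsm.of_le (by simp)).comp (contDiff_norm_sq ℝ))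
    (hasCompactSupport_comp_norm_sq (R := 2 * (2 * (A * Real.exp t))) fun x hx => ?_) ?_).trans
    ((hC _ _ ha hab).trans (le_of_eq ?_))
  · simp [hardyProfile, plateau_eq_zero_of_ge ha hab hx]
  · have hclosed : IsClosed {x : EuclideanSpace ℝ (Fin N) | A / 2 ≤ ‖x‖ ^ 2} :=
      isClosed_le continuous_const (continuous_norm.pow 2)
    intro x hx hxK
    have h1 : A / 2 ≤ ‖x‖ ^ 2 := by
      refine closure_minimal (fun y hy => ?_) hclosed hx
      by_contra h
      exact hy (hzero y (le_of_lt (not_le.1 h)))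
    have h2 : ‖x‖ ^ 2 ≤ r ^ 2 := pow_le_pow_left₀ (norm_nonneg x) (hr x hxK) 2
    rw [hA] at h1
    linarith
  · rw [show 2 * (2 * (A * Real.exp t)) / (A / 2) = 8 * Real.exp t by field_simp; norm_num,
      Real.log_mul (by norm_num) (Real.exp_ne_zero t), Real.log_exp]
    ring

end Growth

lemma exists_nonneg_affine_lt_exp {a b c δ : ℝ} (hδ : 0 < δ) (ha : 0 < a) :
    ∃ t : ℝ, 0 ≤ t ∧ b + c * t < a * Real.exp (δ * t) := by
  have h := (Real.tendsto_exp_div_pow_atTop 1).comp (Filter.tendsto_id.const_mul_atTop hδ)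
  have h2 := h.eventually_gt_atTop ((|b| + |c|) / (a * δ))
  obtain ⟨t, ht, ht1⟩ := (h2.and (Filter.eventually_ge_atTop 1)).exists
  refine ⟨t, by linarith, ?_⟩
  have ht0 : 0 < t := by linarith
  simp only [Function.comp, id, pow_one] at ht
  rw [div_lt_div_iff₀ (by positivity) (by positivity)] at ht
  have h3 : (|b| + |c|) * t < a * Real.exp (δ * t) := by
    have : δ * ((|b| + |c|) * t) < δ * (a * Real.exp (δ * t)) := by linarith
    exact lt_of_mul_lt_mul_left this hδ.le
  nlinarith [le_abs_self b, le_abs_self c, abs_nonneg b]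

/-! ### Comparison of the two bounds -/

section Comparison

variable {N : ℕ} {α : ℝ} {u : EuclideanSpace ℝ (Fin N) → ℝ}

/-- The potential lies below `‖x‖ ^ (2 - N)`, which is the squared Hardy profile away from the
ball `‖x‖ ^ 2 ≤ A`; on that ball it is at most `A ^ (1 - N / 2)`. -/
lemma integral_mul_shellPotential_le (hN : 3 ≤ N)
    (hV : LocallyIntegrable fun x => ‖x‖ ^ α * Real.exp (u x)) {A B : ℝ} (hA : 0 < A)
    (hAB : A ≤ B) :
    ∫ x, ‖x‖ ^ α * Real.exp (u x) * shellPotential N A B (‖x‖ ^ 2) ≤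
      A ^ (1 - (N : ℝ) / 2) *
        (∫ x in {x : EuclideanSpace ℝ (Fin N) | ‖x‖ ^ 2 ≤ A}, ‖x‖ ^ α * Real.exp (u x)) +
      ∫ x, ‖x‖ ^ α * Real.exp (u x) * hardyProfile N (A / 2) (2 * B) (‖x‖ ^ 2) ^ 2 := by
  have hB : 0 < B := hA.trans_le hAB
  have ha : 0 < A / 2 := by positivity
  have hab : A / 2 ≤ 2 * B := by linarith
  set S : Set (EuclideanSpace ℝ (Fin N)) := {x | ‖x‖ ^ 2 ≤ A} with hS
  have hScl : IsClosed S := isClosed_le (continuous_norm.pow 2) continuous_const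
  have hSc : IsCompact S := by
    refine (isCompact_closedBall (0 : EuclideanSpace ℝ (Fin N)) (Real.sqrt A)).of_isClosed_subset
      hScl fun x hx => ?_
    rw [mem_closedBall_zero_iff]
    exact Real.le_sqrt_of_sq_le hx
  have hint : Integrable (S.indicator fun x => ‖x‖ ^ α * Real.exp (u x)) :=
    (integrable_indicator_iff hScl.measurableSet).2 (hV.integrableOn_isCompact hSc)
  have hH := integrable_mul_hardyProfile_sq hV ha hab
  have hcontP : Continuous (shellPotential N A B) := continuous_iff_continuousAt.2 fun s =>
    (hasDerivAt_shellPotential hA hAB s).continuousAt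
  rw [← integral_indicator hScl.measurableSet, ← integral_const_mul,
    ← integral_add (hint.const_mul _) hH]
  refine integral_mono (integrable_mul_of_hasCompactSupport hV
    (hcontP.comp (continuous_norm.pow 2))
    (hasCompactSupport_comp_norm_sq fun x hx => shellPotential_eq_zero hA hAB hx))
    ((hint.const_mul _).add hH) fun x => ?_
  have hv : 0 ≤ ‖x‖ ^ α * Real.exp (u x) := by positivity
  have hvh := mul_nonneg hv (sq_nonneg (hardyProfile N (A / 2) (2 * B) (‖x‖ ^ 2)))
  rcases le_or_gt (‖x‖ ^ 2) A with h | h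
  · have := mul_le_mul_of_nonneg_left (shellPotential_le_const hN hA hAB h) hv
    simp only [Set.indicator_of_mem (show x ∈ S from h)]
    linarith
  · simp only [Set.indicator_of_notMem (show x ∉ S from not_le.2 h), mul_zero, zero_add]
    rcases le_or_gt (2 * B) (‖x‖ ^ 2) with h' | h'
    · rw [shellPotential_eq_zero hA hAB h', mul_zero]
      exact hvh
    · refine mul_le_mul_of_nonneg_left ?_ hv
      rw [hardyProfile_sq (hA.trans h), plateau_eq_one ha (by positivity) (by linarith) h'.le,
        one_pow, mul_one]
      exact shellPotential_le hN hA hAB (hA.trans h)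

lemma integral_mul_shellWeight_le (hV : LocallyIntegrable fun x => ‖x‖ ^ α * Real.exp (u x))
    {A B D : ℝ} (hA : 0 < A) (hAB : A ≤ B) (hD : ∀ t, unitDensity t ≤ D) :
    ∫ x, ‖x‖ ^ α * Real.exp (u x) * shellWeight N B (‖x‖ ^ 2) ≤
      D / B * ∫ x, ‖x‖ ^ α * Real.exp (u x) * hardyProfile N (A / 2) (2 * B) (‖x‖ ^ 2) ^ 2 := by
  have hB : 0 < B := hA.trans_le hAB
  have ha : 0 < A / 2 := by positivity
  have hD0 : 0 ≤ D := (unitDensity_nonneg 0).trans (hD 0)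
  rw [← integral_const_mul]
  refine integral_mono (integrable_mul_of_hasCompactSupport hV
    ((continuous_shellWeight hB).comp (continuous_norm.pow 2))
    (hasCompactSupport_comp_norm_sq fun x hx => shellWeight_eq_zero hB (Or.inr hx)))
    ((integrable_mul_hardyProfile_sq hV ha (by linarith)).const_mul _) fun x => ?_
  have hv : 0 ≤ ‖x‖ ^ α * Real.exp (u x) := by positivity
  have hr : 0 ≤ D / B * (‖x‖ ^ α * Real.exp (u x) *
      hardyProfile N (A / 2) (2 * B) (‖x‖ ^ 2) ^ 2) := by positivity
  rcases le_or_gt (‖x‖ ^ 2) B with h | h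
  · rw [shellWeight_eq_zero hB (Or.inl h), mul_zero]
    exact hr
  rcases le_or_gt (2 * B) (‖x‖ ^ 2) with h' | h'
  · rw [shellWeight_eq_zero hB (Or.inr h'), mul_zero]
    exact hr
  simp only
  rw [hardyProfile_sq (hB.trans h), plateau_eq_one ha (by positivity) (by linarith) h'.le, one_pow,
    mul_one, shellWeight, mul_left_comm (D / B), mul_comm (D / B)]
  refine mul_le_mul_of_nonneg_left (mul_le_mul_of_nonneg_left ?_ ?_) hv
  · exact div_le_div_of_nonneg_right (hD _) hB.le
  · exact Real.rpow_nonneg (sq_nonneg _) _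

end Comparison

theorem theorem1p1 (α : ℝ) (hα : 0 < α) (N : ℕ) (hN : 10 ≤ N) (hNα : (N : ℝ) < 10 + 4 * α) :
    ¬ ∃ u : EuclideanSpace ℝ (Fin N) → ℝ, IsWeakSolution α u ∧ IsStableAtInfinity α u := by
  rintro ⟨u, hu, hs⟩
  have hN3 : 3 ≤ N := by omega
  have hn : (10 : ℝ) ≤ N := by exact_mod_cast hN
  have hV := hu.1
  have hul := hu.2.choose_spec.1.1
  obtain ⟨A, C, hA, hmass⟩ := hs.exists_hardy_mass_le hN3 hV
  obtain ⟨D, hD0, hD⟩ := exists_mul_unitDensity_le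
  set κ := halfSphereArea N with hκ
  have hκ0 : 0 < κ := halfSphereArea_pos hN3
  set n : ℝ := (N : ℝ) with hn_def
  set I := ∫ x, u x * shellWeight N A (‖x‖ ^ 2)
  set M := A ^ (1 - n / 2) *
    ∫ x in {x : EuclideanSpace ℝ (Fin N) | ‖x‖ ^ 2 ≤ A}, ‖x‖ ^ α * Real.exp (u x)
  have hn2 : n - 2 ≠ 0 := by linarith
  -- On the shell `‖x‖ ^ 2 ≈ A * exp t`, the average of `u` is at least `c₀ - (n - 2) / 8 * t`.
  set c₀ : ℝ := (I - (M + κ * C) / (2 * (n - 2))) / κ with hc₀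
  have hgrowth : ∀ t : ℝ, 0 ≤ t →
      A ^ (α / 2) * Real.exp c₀ * κ * Real.exp ((α / 2 + 1 - (n - 2) / 8) * t) ≤
        D / A * (κ * C) + D / A * (κ * ((n - 2) ^ 2 / 4)) * t := by
    intro t ht
    set B := A * Real.exp t with hB
    have hAB : A ≤ B := le_mul_of_one_le_right hA.le (Real.one_le_exp ht)
    have hB0 : 0 < B := hA.trans_le hAB
    have h1 := hmass t ht
    have h2 := integral_mul_shellPotential_le hN3 hV hA hAB
    have h3 := integral_mul_shellWeight_le hV hA hAB fun t => (hD t).1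
    rw [hu.integral_mul_shellPotential hA hAB] at h2
    have hc : (c₀ - (n - 2) / 8 * t) * κ ≤ ∫ x, u x * shellWeight N B (‖x‖ ^ 2) := by
      have h4 : (c₀ - (n - 2) / 8 * t) * κ =
          I - (M + κ * ((n - 2) ^ 2 / 4 * t + C)) / (2 * (n - 2)) := by
        rw [hc₀]; field_simp; ring
      rw [h4, sub_le_comm, le_div_iff₀ (by linarith)]
      linarith
    have h5 := (shell_average_lower_bound hN3 hα.le hV hul hB0 hc).trans
      (h3.trans (mul_le_mul_of_nonneg_left h1 (by positivity)))
    have hBpow : B ^ (α / 2) = A ^ (α / 2) * Real.exp (α / 2 * t) := by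
      rw [hB, Real.mul_rpow hA.le (Real.exp_pos t).le, ← Real.exp_mul, mul_comm t]
    have h6 := mul_le_mul_of_nonneg_right h5 (Real.exp_pos t).le
    calc A ^ (α / 2) * Real.exp c₀ * κ * Real.exp ((α / 2 + 1 - (n - 2) / 8) * t)
        = B ^ (α / 2) * Real.exp (c₀ - (n - 2) / 8 * t) * κ * Real.exp t := by
          rw [hBpow, show (α / 2 + 1 - (n - 2) / 8) * t = α / 2 * t + t - (n - 2) / 8 * t by ring,
            Real.exp_sub, Real.exp_add, Real.exp_sub]
          ring
      _ ≤ D / B * (κ * ((n - 2) ^ 2 / 4 * t + C)) * Real.exp t := h6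
      _ = _ := by
          rw [hB]
          have := Real.exp_ne_zero t
          field_simp
          ring
  obtain ⟨t, ht, hlt⟩ := exists_nonneg_affine_lt_exp
    (a := A ^ (α / 2) * Real.exp c₀ * κ) (b := D / A * (κ * C))
    (c := D / A * (κ * ((n - 2) ^ 2 / 4))) (δ := α / 2 + 1 - (n - 2) / 8) (by linarith)
    (by positivity)
  exact absurd (hgrowth t ht) (not_le.2 hlt)
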